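/- Scalars are real and compact spaces are Hausdorff. For Banach spaces $X,Y$ and $\varepsilon\ge 0$, a map $f:X\to Y$ is a standard $\varepsilon$-isometry if $f(0)=0$ and $\bigl|\,\|f(x)-f(y)\|-\|x-y\|\,\bigr|\le\varepsilon$ for all $x,y\in X$; let $L(f)$ be the closure of $\operatorname{span} f(X)$ in $Y$. For $\alpha,\gamma>0$, the pair $(X,Y)$ is called $(\alpha,\gamma)$-stable if for every $\varepsilon\ge 0$ and every standard $\varepsilon$-isometry $f:X\to Y$ there is a bounded linear operator $T:L(f)\to X$ with $\|T\|\le\alpha$ and $\|Tf(x)-x\|\le\gamma\varepsilon$ for all $x\in X$. For a topological space $K$ put $K^{(0)}=K$ and let $K^{(m+1)}$ be the derived set (set of accumulation points) of $K^{(m)}$; $K$ has height $n$ if $K^{(n)}=\emptyset$. Let $n\ge 1$ be an integer and let $K$ be a compact Hausdorff space of height $n$. Then for every separable Banach space $Y$ the pair $(C(K),Y)$ is $(6n-3,\,24n-12)$-stable, where $C(K)$ is the Banach space of real-valued continuous functions on $K$ with the supremum norm. -/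

import Mathlib

open Set Topology

/-- `L(f)`: the closure in `Y` of the linear span of the range of `f`. -/
def closedSpanRange {X Y : Type*} [NormedAddCommGroup Y] [NormedSpace ℝ Y]
    (f : X → Y) : Submodule ℝ Y :=
  (Submodule.span ℝ (range f)).topologicalClosure

theorem mem_closedSpanRange {X Y : Type*} [NormedAddCommGroup Y] [NormedSpace ℝ Y]
    (f : X → Y) (x : X) : f x ∈ closedSpanRange f :=
  Submodule.le_topologicalClosure _ (Submodule.subset_span (mem_range_self x))

section Stability

variable {X Y : Type*} [NormedAddCommGroup X] [NormedSpace ℝ X]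
  [NormedAddCommGroup Y] [NormedSpace ℝ Y]

/-- A standard `ε`-isometry: `f 0 = 0` and `| ‖f x - f y‖ - ‖x - y‖ | ≤ ε` for all `x`, `y`.
No continuity or linearity is assumed. -/
structure IsStandardEpsIsometry (ε : ℝ) (f : X → Y) : Prop where
  map_zero : f 0 = 0
  abs_le : ∀ x y : X, |‖f x - f y‖ - ‖x - y‖| ≤ ε

/-- The map `f`, regarded as an `ε`-isometry, is `(α, γ)`-stable: `α, γ > 0` and there is a
bounded linear operator `T : L(f) → X` with `‖T‖ ≤ α` and `‖T (f x) - x‖ ≤ γ ε` for all `x`. -/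
def IsStableEpsIsometry (α γ ε : ℝ) (f : X → Y) : Prop :=
  0 < α ∧ 0 < γ ∧ ∃ T : closedSpanRange f →L[ℝ] X,
    ‖T‖ ≤ α ∧ ∀ x : X, ‖T ⟨f x, mem_closedSpanRange f x⟩ - x‖ ≤ γ * ε

variable (X Y) in
/-- The pair `(X, Y)` is `(α, γ)`-stable: `α, γ > 0` and, for every `ε ≥ 0`, every standard
`ε`-isometry `X → Y` is `(α, γ)`-stable. -/
def IsStablePair (α γ : ℝ) : Prop :=
  0 < α ∧ 0 < γ ∧ ∀ ε : ℝ, 0 ≤ ε → ∀ f : X → Y,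
    IsStandardEpsIsometry ε f → IsStableEpsIsometry α γ ε f

end Stability

/-- The `n`-th Cantor-Bendixson derivative: `K⁽⁰⁾ = K` and `K⁽ⁿ⁺¹⁾` is the set of accumulation
points of `K⁽ⁿ⁾`. -/
def iteratedDerivedSet (K : Type*) [TopologicalSpace K] : ℕ → Set K
  | 0 => univ
  | n + 1 => derivedSet (iteratedDerivedSet K n)

/-- `K` has height `n`: its `n`-th Cantor-Bendixson derivative is empty. (Minimality of `n` is
not demanded.) -/
def HasHeight (K : Type*) [TopologicalSpace K] (n : ℕ) : Prop :=
  iteratedDerivedSet K n = ∅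

open Filter

/-! ### Cantor-Bendixson derivatives -/

section DerivedSets

/-! A weak-* continuous family of functionals `g k` close to the evaluations gives `T y = (k ↦ g k
y)`. At an isolated point a functional in the dual ball is `3ε`-close to evaluation; finite height
makes isolated points dense, so compactness yields one at every point. Since `Y` is separable, these
pairs `(k, φ)` form a compact metrizable space over `K`. Induction up from `K⁽ⁿ⁾ = ∅` extends a
continuous choice one level at a time, adding a difference of two such functionals; after `n` levels
the bounds are `2n - 1` and `(2n - 1) 3ε`, stronger than required. -/

theorem isClosed_iteratedDerivedSet (K : Type*) [TopologicalSpace K] [T1Space K] (m : ℕ) :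
    IsClosed (iteratedDerivedSet K m) := by
  cases m with
  | zero => exact isClosed_univ
  | succ m => exact isClosed_derivedSet _

/-- In a space of finite height the isolated points are dense. -/
theorem HasHeight.dense_isolated {K : Type*} [TopologicalSpace K] {n : ℕ} (hK : HasHeight K n) :
    Dense {k : K | IsOpen ({k} : Set K)} := by
  rw [dense_iff_inter_open]
  intro U hU hne
  by_contra hcon
  have hacc : ∀ x ∈ U, AccPt x (𝓟 U) := by
    intro x hx
    have hnb : NeBot (𝓝[≠] x) := by
      rw [neBot_iff]
      intro h
      exact hcon ⟨x, hx, isOpen_singleton_iff_punctured_nhds x |>.2 h⟩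
    have hle : 𝓝[≠] x ≤ 𝓟 U := nhdsWithin_le_nhds.trans (le_principal_iff.2 (hU.mem_nhds hx))
    change NeBot (𝓝[≠] x ⊓ 𝓟 U)
    rwa [inf_eq_left.2 hle]
  -- An open set without isolated points survives every derivation.
  have hsub : ∀ m, U ⊆ iteratedDerivedSet K m := by
    intro m
    induction m with
    | zero => exact subset_univ _
    | succ m ih => exact fun x hx => (hacc x hx).mono (principal_mono.2 ih)
  obtain ⟨x, hx⟩ := hne
  have hmem := hsub n hx
  rw [hK] at hmem
  exact hmem

end DerivedSets

/-! ### Continuous selection by height -/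

section Selection

variable {P K W : Type*} [MetricSpace P] [CompactSpace P] [TopologicalSpace K] [CompactSpace K]
  [T2Space K] [AddCommGroup W] [TopologicalSpace W] [IsTopologicalAddGroup W]

/-- Let `q : P → K` be a continuous surjection with section `s`, and let `t k` be a point of
`q ⁻¹' A` nearest to `s k`. A map `g` continuous on `A` is turned into
`k ↦ i (s k) - i (t k) + g (q (t k))`, which is continuous at every point of `A`. -/
theorem continuousAt_sub_add_of_nearest {q : P → K} (hq : Continuous q) {i : P → W}
    (hi : Continuous i) {s t : K → P} (hs : ∀ k, q (s k) = k) {A : Set K}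
    (htA : ∀ k, q (t k) ∈ A)
    (ht : ∀ k, Metric.infDist (s k) (q ⁻¹' A) = dist (s k) (t k)) {g : K → W}
    (hg : ContinuousOn g A) {a : K} (ha : a ∈ A) :
    ContinuousAt (fun k => i (s k) - i (t k) + g (q (t k))) a := by
  let _ : UniformSpace K := uniformSpaceOfCompactR1
  let _ : UniformSpace W := IsTopologicalAddGroup.rightUniformSpace W
  have : IsUniformAddGroup W := isUniformAddGroup_of_addCommGroup
  have hzero : ∀ k ∈ A, t k = s k := by
    intro k hk
    have h0 : Metric.infDist (s k) (q ⁻¹' A) = 0 :=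
      Metric.infDist_zero_of_mem (by simpa [hs] using hk)
    rw [ht] at h0
    exact (dist_eq_zero.1 h0).symm
  -- `s` need not be continuous, but as `q` is a closed map, `s k` approaches the fibre over `a`.
  have hs_lim : Tendsto s (𝓝 a) (𝓝ˢ (q ⁻¹' {a})) := by
    rw [← hq.isClosedMap.comap_nhds_eq hq, tendsto_comap_iff]
    have : q ∘ s = id := funext hs
    rw [this]
    exact tendsto_id
  have hdist : Tendsto (fun k => dist (s k) (t k)) (𝓝 a) (𝓝 0) := by
    simp only [← ht]
    refine Tendsto.comp (g := fun p => Metric.infDist p (q ⁻¹' A)) ?_ hs_lim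
    refine (Metric.continuous_infDist_pt (q ⁻¹' A)).tendsto_nhdsSet_nhds fun p hp => ?_
    refine Metric.infDist_zero_of_mem ?_
    have : q p = a := hp
    simpa [this] using ha
  have hunif : Tendsto (fun k => (s k, t k)) (𝓝 a) (uniformity P) :=
    tendsto_uniformity_iff_dist_tendsto_zero.2 hdist
  have hqt : Tendsto (fun k => q (t k)) (𝓝 a) (𝓝 a) := by
    have h1 : Tendsto (fun k => (q (s k), q (t k))) (𝓝 a) (uniformity K) :=
      Tendsto.comp (CompactSpace.uniformContinuous_of_continuous hq) hunif
    simp only [hs] at h1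
    exact tendsto_id.congr_uniformity h1
  have hdiff : Tendsto (fun k => i (s k) - i (t k)) (𝓝 a) (𝓝 0) := by
    have h1 : Tendsto (fun k => (i (t k), i (s k))) (𝓝 a) (uniformity W) :=
      Tendsto.comp (CompactSpace.uniformContinuous_of_continuous hi)
        (tendsto_swap_uniformity.comp hunif)
    rw [uniformity_eq_comap_nhds_zero W, tendsto_comap_iff] at h1
    exact h1
  have hgt : Tendsto (fun k => g (q (t k))) (𝓝 a) (𝓝 (g a)) :=
    Tendsto.comp (hg a ha) (tendsto_nhdsWithin_iff.2 ⟨hqt, Eventually.of_forall htA⟩)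
  have hsum := hdiff.add hgt
  have hval : i (s a) - i (t a) + g (q (t a)) = 0 + g a := by
    rw [hzero a ha, hs, sub_self]
  rwa [← hval] at hsum

/-- Continuous selection over a compact space of height `n`: each stage of the Cantor-Bendixson
filtration moves the values from `C m` to `C (m + 1)`. -/
theorem HasHeight.exists_continuous_selection {n : ℕ} (hK : HasHeight K n) {q : P → K}
    (hq : Continuous q) (hsurj : Function.Surjective q) {i : P → W} (hi : Continuous i)
    (C : ℕ → K → Set W) (hC : ∀ m p, i p ∈ C (m + 1) (q p))
    (hstep : ∀ m p p', ∀ w ∈ C m (q p'), i p - i p' + w ∈ C (m + 1) (q p)) :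
    ∃ g : K → W, Continuous g ∧ ∀ k, g k ∈ C n k := by
  obtain ⟨s, hs⟩ := hsurj.hasRightInverse
  have key : ∀ m ≤ n, ∃ g : K → W, ContinuousOn g (iteratedDerivedSet K (n - m)) ∧
      ∀ k ∈ iteratedDerivedSet K (n - m), g k ∈ C m k := by
    intro m
    induction m with
    | zero =>
      intro _
      have hempty : iteratedDerivedSet K n = ∅ := hK
      refine ⟨fun _ => 0, continuousOn_const, ?_⟩
      simp [hempty]
    | succ m ih =>
      intro hm
      obtain ⟨g, hg, hgC⟩ := ih (by omega)
      have hsucc : n - m = n - (m + 1) + 1 := by omega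
      set A := iteratedDerivedSet K (n - m) with hA
      set A' := iteratedDerivedSet K (n - (m + 1)) with hA'
      have hder : A = derivedSet A' := by rw [hA, hsucc]; rfl
      -- Points of `A' \ A` are isolated in `A'`, so continuity is at stake only on `A`.
      have hisol : ∀ h : K → W, (∀ a ∈ A, ContinuousAt h a) → ContinuousOn h A' := by
        intro h hcont x hx
        by_cases hxA : x ∈ A
        · exact (hcont x hxA).continuousWithinAt
        · have hbot : 𝓝[≠] x ⊓ 𝓟 A' = ⊥ := by
            rw [hder] at hxA
            exact not_neBot.1 hxA
          have hx' : 𝓝[A' \ {x}] x = ⊥ := by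
            rw [← hbot, nhdsWithin, nhdsWithin, inf_assoc, inf_principal, sdiff_eq, inter_comm]
          exact continuousWithinAt_sdiff_self.1 (by
            rw [ContinuousWithinAt, hx']; exact tendsto_bot)
      rcases A.eq_empty_or_nonempty with hAe | ⟨a₀, ha₀⟩
      · refine ⟨fun k => i (s k), hisol _ (by simp [hAe]), fun k _ => ?_⟩
        have := hC m (s k)
        rwa [hs k] at this
      · have hclosed : IsClosed (q ⁻¹' A) := (isClosed_iteratedDerivedSet K _).preimage hq
        have hne : (q ⁻¹' A).Nonempty := ⟨s a₀, by simpa [hs a₀] using ha₀⟩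
        choose t htA ht using fun k => hclosed.isCompact.exists_infDist_eq_dist hne (s k)
        refine ⟨fun k => i (s k) - i (t k) + g (q (t k)),
          hisol _ fun a ha => continuousAt_sub_add_of_nearest hq hi hs htA ht hg ha,
          fun k _ => ?_⟩
        have := hstep m (s k) (t k) _ (hgC _ (htA k))
        rwa [hs k] at this
  obtain ⟨g, hg, hgC⟩ := key n le_rfl
  rw [Nat.sub_self] at hg hgC
  exact ⟨g, continuousOn_univ.1 hg, fun k => hgC k (mem_univ k)⟩

end Selection

/-! ### Functionals close to evaluations -/

section Functionals

variable {K : Type*} [TopologicalSpace K] [CompactSpace K]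
  {Y : Type*} [NormedAddCommGroup Y] [NormedSpace ℝ Y]

/-- The pairs `(k, φ)` such that `φ` lies in the dual unit ball and `φ ∘ f` is uniformly
`δ`-close to evaluation at `k`. -/
def nearEvaluations (f : C(K, ℝ) → Y) (δ : ℝ) : Set (K × WeakDual ℝ Y) :=
  {z | z.2 ∈ WeakDual.toStrongDual ⁻¹' Metric.closedBall 0 1 ∧ ∀ x, |z.2 (f x) - x z.1| ≤ δ}

theorem isCompact_nearEvaluations (f : C(K, ℝ) → Y) (δ : ℝ) :
    IsCompact (nearEvaluations f δ) := by
  have hball : IsCompact ((univ : Set K) ×ˢ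
      (WeakDual.toStrongDual ⁻¹' Metric.closedBall (0 : StrongDual ℝ Y) 1)) :=
    isCompact_univ.prod (WeakDual.isCompact_closedBall 0 1)
  have hclosed : IsClosed {z : K × WeakDual ℝ Y | ∀ x, |z.2 (f x) - x z.1| ≤ δ} := by
    rw [ofPred_forall]
    refine isClosed_iInter fun x => isClosed_le ?_ continuous_const
    exact (((WeakDual.eval_continuous (f x)).comp continuous_snd).sub
      (x.continuous.comp continuous_fst)).abs
  convert hball.inter_right hclosed using 1
  ext z
  simp [nearEvaluations]

theorem eq_of_mem_nearEvaluations [T2Space K] {f : C(K, ℝ) → Y} {δ : ℝ} {k k' : K}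
    {φ : WeakDual ℝ Y} (h : (k, φ) ∈ nearEvaluations f δ) (h' : (k', φ) ∈ nearEvaluations f δ) :
    k = k' := by
  by_contra hne
  obtain ⟨x, hx0, hx1, -⟩ := exists_continuous_zero_one_of_isClosed
    (isClosed_singleton (x := k)) (isClosed_singleton (x := k'))
    (disjoint_singleton.2 hne)
  have h0 : x k = 0 := hx0 rfl
  have h1 : x k' = 1 := hx1 rfl
  -- The factor `2 * δ + 1` makes the two values too far apart to be `δ`-close to one number.
  have e := abs_le.1 (h.2 ((2 * δ + 1) • x))
  have e' := abs_le.1 (h'.2 ((2 * δ + 1) • x))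
  simp only [ContinuousMap.smul_apply, smul_eq_mul, h0, h1] at e e'
  linarith [e.1, e.2, e'.1, e'.2]

/-- `K` need not be metrizable: `φ` determines `k`, so countably many evaluations on `Y` separate
the pairs. -/
theorem metrizableSpace_nearEvaluations [T2Space K] [TopologicalSpace.SeparableSpace Y]
    (f : C(K, ℝ) → Y) (δ : ℝ) : TopologicalSpace.MetrizableSpace (nearEvaluations f δ) := by
  have : CompactSpace (nearEvaluations f δ) :=
    isCompact_iff_compactSpace.1 (isCompact_nearEvaluations f δ)
  obtain ⟨gs, hgs, hsep⟩ := WeakDual.exists_countable_separating ℝ Y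
  refine Metric.PiNatEmbed.TopologicalSpace.MetrizableSpace.of_countable_separating
    (fun m z => gs m z.1.2) (fun m => (hgs m).comp (continuous_snd.comp continuous_subtype_val)) ?_
  rintro ⟨⟨k, φ⟩, h⟩ ⟨⟨k', φ'⟩, h'⟩ hne
  refine hsep fun heq => hne ?_
  change φ = φ' at heq
  subst heq
  have := eq_of_mem_nearEvaluations h h'
  subst this
  rfl

/-- Norming functionals of `f (t e) - f (-t e)`, for `e` the indicator of an isolated point `k`
and `t` large, are almost evaluation at `k`. -/
theorem IsStandardEpsIsometry.exists_functional_of_isolated {ε : ℝ} {f : C(K, ℝ) → Y}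
    (hf : IsStandardEpsIsometry ε f) {k : K} (hk : IsClopen ({k} : Set K)) (t : ℝ) (ht : 0 ≤ t) :
    ∃ φ : StrongDual ℝ Y, ‖φ‖ ≤ 1 ∧ ∀ x : C(K, ℝ), 2 * ‖x‖ ≤ t → |φ (f x) - x k| ≤ 3 * ε := by
  classical
  let e : C(K, ℝ) := ⟨indicator {k} 1, continuous_one.indicator (by simp [hk.frontier_eq])⟩
  have hek : e k = 1 := by simp [e]
  have hej : ∀ j, j ≠ k → e j = 0 := fun j hj => by simp [e, hj]
  obtain ⟨φ, hφ, hφv⟩ := exists_dual_vector'' ℝ (f (t • e) - f (-(t • e)))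
  have hle : ∀ u v, φ (f u) - φ (f v) ≤ ‖u - v‖ + ε := by
    intro u v
    have h1 : φ (f u - f v) ≤ ‖f u - f v‖ :=
      (le_abs_self _).trans ((φ.le_opNorm _).trans (by nlinarith [norm_nonneg (f u - f v)]))
    rw [map_sub] at h1
    linarith [(_root_.abs_le.1 (hf.abs_le u v)).2]
  -- Off `k`, `|x j| ≤ ‖x‖ ≤ t - ‖x‖ ≤ t - x k`.
  have hnorm : ∀ x : C(K, ℝ), 2 * ‖x‖ ≤ t → ‖t • e - x‖ ≤ t - x k := by
    intro x hx
    have hb : ∀ j, |x j| ≤ ‖x‖ := fun j => x.norm_coe_le_norm j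
    have hkb := _root_.abs_le.1 (hb k)
    rw [ContinuousMap.norm_le _ (by linarith [norm_nonneg x])]
    intro j
    rw [Real.norm_eq_abs, _root_.abs_le]
    have hjb := _root_.abs_le.1 (hb j)
    by_cases hj : j = k
    · subst hj
      simp only [ContinuousMap.sub_apply, ContinuousMap.smul_apply, smul_eq_mul, hek]
      constructor <;> linarith [norm_nonneg x]
    · simp only [ContinuousMap.sub_apply, ContinuousMap.smul_apply, smul_eq_mul, hej j hj]
      constructor <;> linarith
  have hplus := hle (t • e) 0
  have hminus := hle 0 (-(t • e))
  have hn0 := hnorm 0 (by simpa using ht)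
  simp only [sub_zero, ContinuousMap.zero_apply] at hn0
  rw [hf.map_zero, _root_.map_zero, sub_zero, sub_zero] at hplus
  rw [hf.map_zero, _root_.map_zero, zero_sub, zero_sub, neg_neg] at hminus
  have hlow : 2 * t - ε ≤ φ (f (t • e)) - φ (f (-(t • e))) := by
    rw [← map_sub, hφv]
    have h1 := (_root_.abs_le.1 (hf.abs_le (t • e) (-(t • e)))).1
    have h2 : 2 * t ≤ ‖t • e - -(t • e)‖ := by
      refine le_trans ?_ ((t • e - -(t • e)).norm_coe_le_norm k)
      refine le_trans (le_of_eq ?_) (le_abs_self _)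
      simp [hek]
      ring
    simp only [RCLike.ofReal_real_eq_id, id]
    linarith
  -- `hlow` and `hminus` give `φ (f (t • e)) ≥ t - 2ε`, and symmetrically at `-(t • e)`; comparison
  -- with `f x` costs one more `ε`.
  refine ⟨φ, hφ, fun x hx => ?_⟩
  have h1 := hle (t • e) x
  have h2 := hle x (-(t • e))
  have h3 := hnorm x hx
  have h4 := hnorm (-x) (by simpa using hx)
  rw [show x - -(t • e) = t • e - -x by abel] at h2
  simp only [ContinuousMap.neg_apply] at h4
  rw [_root_.abs_le]
  constructor <;> linarith

/-- A weak-* limit as `t → ∞` removes the restriction on `‖x‖`. -/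
theorem IsStandardEpsIsometry.exists_mem_nearEvaluations_of_isolated {ε : ℝ} {f : C(K, ℝ) → Y}
    (hf : IsStandardEpsIsometry ε f) {k : K} (hk : IsClopen ({k} : Set K)) :
    ∃ φ, (k, φ) ∈ nearEvaluations f (3 * ε) := by
  choose φ hφ hφx using fun m : ℕ => hf.exists_functional_of_isolated hk m m.cast_nonneg
  let w : ℕ → WeakDual ℝ Y := fun m => StrongDual.toWeakDual (φ m)
  have hmem : ∀ m, w m ∈ WeakDual.toStrongDual ⁻¹' Metric.closedBall (0 : StrongDual ℝ Y) 1 :=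
    fun m => mem_closedBall_zero_iff.2 (hφ m)
  obtain ⟨ψ, hψ, hlim⟩ := (WeakDual.isCompact_closedBall (0 : StrongDual ℝ Y) 1).ultrafilter_le_nhds
    ((hyperfilter ℕ).map w) (le_principal_iff.2 (Filter.Eventually.of_forall (p := fun m => w m ∈ _) hmem))
  refine ⟨ψ, hψ, fun x => ?_⟩
  have hlim' : Tendsto w (hyperfilter ℕ) (𝓝 ψ) := hlim
  have hx : Tendsto (fun m => |w m (f x) - x k|) (hyperfilter ℕ) (𝓝 |ψ (f x) - x k|) :=
    ((((WeakDual.eval_continuous (f x)).tendsto ψ).comp hlim').sub_const _).abs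
  refine le_of_tendsto hx ?_
  have hev : ∀ᶠ m : ℕ in atTop, 2 * ‖x‖ ≤ (m : ℝ) :=
    tendsto_natCast_atTop_atTop.eventually_ge_atTop _
  exact (hev.filter_mono Nat.hyperfilter_le_atTop).mono fun m hm => hφx m x hm

theorem IsStandardEpsIsometry.surjective_nearEvaluations [T2Space K] {n : ℕ}
    (hK : HasHeight K n) {ε : ℝ} {f : C(K, ℝ) → Y} (hf : IsStandardEpsIsometry ε f) :
    Function.Surjective fun z : nearEvaluations f (3 * ε) => z.1.1 := by
  have hclosed : IsClosed (Prod.fst '' nearEvaluations f (3 * ε)) :=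
    ((isCompact_nearEvaluations f (3 * ε)).image continuous_fst).isClosed
  have huniv : Prod.fst '' nearEvaluations f (3 * ε) = univ := by
    refine eq_univ_of_univ_subset ?_
    rw [← hK.dense_isolated.closure_eq]
    refine closure_minimal (fun k hk => ?_) hclosed
    obtain ⟨φ, hφ⟩ := hf.exists_mem_nearEvaluations_of_isolated ⟨isClosed_singleton, hk⟩
    exact ⟨_, hφ, rfl⟩
  intro k
  obtain ⟨z, hz, rfl⟩ := huniv.symm ▸ mem_univ k
  exact ⟨⟨z, hz⟩, rfl⟩

/-- A weak-* continuous choice of functionals close to the evaluations. -/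
theorem IsStandardEpsIsometry.exists_continuous_functionals [T2Space K] {n : ℕ}
    (hK : HasHeight K n) [TopologicalSpace.SeparableSpace Y] {ε : ℝ}
    (hε : 0 ≤ ε) {f : C(K, ℝ) → Y} (hf : IsStandardEpsIsometry ε f) :
    ∃ g : K → WeakDual ℝ Y, Continuous g ∧ ∀ k, (∀ y, |g k y| ≤ (2 * n - 1) * ‖y‖) ∧
      ∀ x, |g k (f x) - x k| ≤ (2 * n - 1) * (3 * ε) := by
  have : CompactSpace (nearEvaluations f (3 * ε)) :=
    isCompact_iff_compactSpace.1 (isCompact_nearEvaluations f (3 * ε))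
  have := metrizableSpace_nearEvaluations f (3 * ε)
  let _ := TopologicalSpace.metrizableSpaceMetric (nearEvaluations f (3 * ε))
  have hball : ∀ (z : nearEvaluations f (3 * ε)) (y : Y), |z.1.2 y| ≤ ‖y‖ := fun z y =>
    (ContinuousLinearMap.le_of_opNorm_le (WeakDual.toStrongDual z.1.2)
      (mem_closedBall_zero_iff.1 z.2.1) y).trans_eq (one_mul _)
  refine hK.exists_continuous_selection (q := fun z : nearEvaluations f (3 * ε) => z.1.1)
    (i := fun z => z.1.2)
    (continuous_fst.comp continuous_subtype_val) (hf.surjective_nearEvaluations hK)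
    (continuous_snd.comp continuous_subtype_val)
    -- Each level adds two functionals of bound 1, whence `2 * m - 1`; the negative bound at `m = 0`
    -- is harmless over the empty set.
    (fun m k => {w | (∀ y, |w y| ≤ (2 * m - 1) * ‖y‖) ∧
      ∀ x, |w (f x) - x k| ≤ (2 * m - 1) * (3 * ε)}) ?_ ?_
  · intro m z
    have hm : (0 : ℝ) ≤ m := m.cast_nonneg
    refine ⟨fun y => ?_, fun x => ?_⟩
    · have := hball z y
      have := mul_nonneg hm (norm_nonneg y)
      push_cast
      linarith
    · have := z.2.2 x
      have := mul_nonneg hm hε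
      push_cast
      linarith
  · rintro m z z' w ⟨hw, hwx⟩
    refine ⟨fun y => ?_, fun x => ?_⟩
    · have h1 := _root_.abs_le.1 (hball z y)
      have h2 := _root_.abs_le.1 (hball z' y)
      have h3 := _root_.abs_le.1 (hw y)
      change |z.1.2 y - z'.1.2 y + w y| ≤ _
      push_cast
      rw [_root_.abs_le]
      constructor <;> linarith
    · have h1 := _root_.abs_le.1 (z.2.2 x)
      have h2 := _root_.abs_le.1 (z'.2.2 x)
      have h3 := _root_.abs_le.1 (hwx x)
      change |z.1.2 (f x) - z'.1.2 (f x) + w (f x) - x z.1.1| ≤ _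
      push_cast
      rw [_root_.abs_le]
      constructor <;> linarith

end Functionals

/-- The corestriction of a standard `ε`-isometry `f` to `L(f)` is a standard `ε`-isometry. -/
theorem IsStandardEpsIsometry.codRestrict_closedSpanRange {X Y : Type*} [NormedAddCommGroup X]
    [NormedSpace ℝ X] [NormedAddCommGroup Y] [NormedSpace ℝ Y] {ε : ℝ} {f : X → Y}
    (hf : IsStandardEpsIsometry ε f) :
    IsStandardEpsIsometry ε
      fun x => (⟨f x, mem_closedSpanRange f x⟩ : closedSpanRange f) :=
  ⟨Subtype.ext hf.map_zero, hf.abs_le⟩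

theorem corollary4p3 {K : Type*} [TopologicalSpace K] [CompactSpace K] [T2Space K]
    (n : ℕ) (hn : 1 ≤ n) (hK : HasHeight K n)
    {Y : Type*} [NormedAddCommGroup Y] [NormedSpace ℝ Y] [CompleteSpace Y]
    [TopologicalSpace.SeparableSpace Y] :
    IsStablePair C(K, ℝ) Y (6 * (n : ℝ) - 3) (24 * (n : ℝ) - 12) := by
  have hn' : (1 : ℝ) ≤ n := by exact_mod_cast hn
  refine ⟨by linarith, by linarith, fun ε hε f hf => ⟨by linarith, by linarith, ?_⟩⟩
  -- Second countability passes to the subspace `L(f)`, making it separable.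
  have := UniformSpace.secondCountable_of_separable Y
  obtain ⟨g, hg, hgk⟩ := hf.codRestrict_closedSpanRange.exists_continuous_functionals hK hε
  have hcont : ∀ y, Continuous fun k => g k y := fun y => (WeakDual.eval_continuous y).comp hg
  let T₀ : closedSpanRange f →ₗ[ℝ] C(K, ℝ) :=
    { toFun := fun y => ⟨fun k => g k y, hcont y⟩
      map_add' := fun y z => by ext k; exact map_add (g k) y z
      map_smul' := fun c y => by ext k; exact map_smul (g k) c y }
  have hT₀ : ∀ y, ‖T₀ y‖ ≤ (2 * n - 1) * ‖y‖ := fun y =>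
    (ContinuousMap.norm_le _ (mul_nonneg (by linarith) (norm_nonneg y))).2 fun k => (hgk k).1 y
  refine ⟨T₀.mkContinuous _ hT₀, ?_, fun x => ?_⟩
  · exact (T₀.mkContinuous_norm_le (by linarith) hT₀).trans (by linarith)
  · rw [ContinuousMap.norm_le _ (mul_nonneg (by linarith) hε)]
    intro k
    refine ((hgk k).2 x).trans ?_
    nlinarith
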